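/- Fix a photon cutoff $\Lambda$ and an integer $k$ with $1\le k\le\Lambda$. Let $\mathcal H_\Lambda$ have orthonormal basis $|0\rangle,\dots,|\Lambda\rangle$, let $a$ be the truncated annihilation operator, $a|n\rangle=\sqrt n\,|n-1\rangle$ ($a|0\rangle=0$), and $a^\dagger$ its adjoint. On $\mathbb C^2\otimes\mathcal H_\Lambda$ write $\begin{bmatrix}0&B\\C&0\end{bmatrix}=|0\rangle\langle1|\otimes B+|1\rangle\langle0|\otimes C$ and, for $t\in\mathbb R$, $$\mathcal T_k(t)=\exp\left(it\begin{bmatrix}0&(a^\dagger)^k\\a^k&0\end{bmatrix}\right),\qquad \mathcal P_k(t)=\exp\left(it\begin{bmatrix}0&(a^\dagger)^k|0\rangle\langle0|\\|0\rangle\langle0|a^k&0\end{bmatrix}\right),\qquad R_{Z0}=\mathbf 1\otimes(\mathbf 1-2|0\rangle\langle0|).$$ (1) $\mathcal P_k(t)$ is unitary for all real $t$. If $t=(2n+1)\frac{\pi}{2\sqrt{k!}}$ with $n\in\mathbb N=\{0,1,2,\dots\}$, then $\mathcal P_k(t)$ maps $|1\rangle\otimes|0\rangle$ to $|0\rangle\otimes|k\rangle$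 up to a phase, precisely $$\mathcal P_k(t)\,|1\rangle\otimes|0\rangle=i(-1)^n\,|0\rangle\otimes|k\rangle ,$$ and $\mathcal P_k(t)\,|1\rangle\otimes|b\rangle=|1\rangle\otimes|b\rangle$ for $1\le b\le\Lambda$. (2) Let $p\ge1$ be real and $q=\max(\lceil\frac{p-1}2\rceil,1)$. For operator-valued functions $U_1,U_2$ of time let $\mathrm{Trotter}_2(U_1,U_2)(t)=U_1(\frac t2)U_2(\frac t2)U_2(\frac t2)U_1(\frac t2)$ and, for $j\ge2$ and $c_j=(4-4^{1/(2j-1)})^{-1}$, let $\mathrm{Trotter}_{2j}(t)=[\mathrm{Trotter}_{2j-2}(c_jt)]^2\,\mathrm{Trotter}_{2j-2}((1-4c_j)t)\,[\mathrm{Trotter}_{2j-2}(c_jt)]^2$. Given an approximate subroutine $s\mapsto\widetilde{\mathcal T}_{k,p}(s)$, $s\in\mathbb R$, put $$\widetilde{\mathcal P}_{k,p}(t)=\mathrm{Trotter}_{2q}(U_1,U_2)(t),\qquad U_1(s)=\widetilde{\mathcal T}_{k,p}(s/2),\quad U_2(s)=R_{Z0}\,\widetilde{\mathcal T}_{k,p}(-s/2)\,R_{Z0}.$$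 This circuit calls the subroutine $\widetilde{\mathcal T}_{k,p}$ at most $4\cdot5^{q-1}$ times. Write $\|\cdot\|$ for the operator norm. If $\|\widetilde{\mathcal T}_{k,p}(s)-\mathcal T_k(s)\|\in O((\Lambda^{k/2}|s|)^p)$, then $$\|\widetilde{\mathcal P}_{k,p}(t)-\mathcal P_k(t)\|\in O((\Lambda^{k/2}|t|)^p).$$ Explicitly: for all $p\ge 1$ and $C_0,\delta_0>0$ there are $C,\delta>0$, depending only on $p,C_0,\delta_0$, such that for all $1\le k\le\Lambda$ and all $\widetilde{\mathcal T}_{k,p}$ with $\|\widetilde{\mathcal T}_{k,p}(s)-\mathcal T_k(s)\|\le C_0(\Lambda^{k/2}|s|)^p$ whenever $\Lambda^{k/2}|s|\le\delta_0$, one has $\|\widetilde{\mathcal P}_{k,p}(t)-\mathcal P_k(t)\|\le C(\Lambda^{k/2}|t|)^p$ whenever $\Lambda^{k/2}|t|\le\delta$; if moreover every $\widetilde{\mathcal T}_{k,p}(s)$ is unitary, then every $\widetilde{\mathcal P}_{k,p}(t)$ is unitary and the bound holds, with the same $C$, for all real $t$. -/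

import Mathlib

open scoped Matrix Kronecker Matrix.Norms.L2Operator

noncomputable section

namespace FockPrep

/-- Operators on `ℋ₂ ⊗ ℋ_Λ`, one qubit and one bosonic mode with at most `Λ` photons,
in the basis `|q⟩ ⊗ |m⟩`, `q ∈ {0,1}`, `0 ≤ m ≤ Λ`. The norm is the operator norm
induced by the Euclidean norm. -/
abbrev Op (Λ : ℕ) : Type := Matrix (Fin 2 × Fin (Λ + 1)) (Fin 2 × Fin (Λ + 1)) ℂ

/-- The basis state `|q⟩ ⊗ |m⟩`. -/
def ket {Λ : ℕ} (q : Fin 2) (m : Fin (Λ + 1)) : Fin 2 × Fin (Λ + 1) → ℂ := Pi.single (q, m) 1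

/-- The truncated annihilation operator: `a |n⟩ = √n |n-1⟩`. -/
def annihilation (Λ : ℕ) : Matrix (Fin (Λ + 1)) (Fin (Λ + 1)) ℂ :=
  Matrix.of fun m n => if (m : ℕ) + 1 = n then ((Real.sqrt (n : ℕ) : ℝ) : ℂ) else 0

/-- The truncated creation operator `a†`. -/
def creation (Λ : ℕ) : Matrix (Fin (Λ + 1)) (Fin (Λ + 1)) ℂ := (annihilation Λ)ᴴ

/-- The vacuum projector `|0⟩⟨0|` on the mode. -/
def vacuumProj (Λ : ℕ) : Matrix (Fin (Λ + 1)) (Fin (Λ + 1)) ℂ := Matrix.single 0 0 1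

/-- The block matrix `[[0, B], [C, 0]]`, that is `|0⟩⟨1| ⊗ B + |1⟩⟨0| ⊗ C`. -/
def offDiag {Λ : ℕ} (B C : Matrix (Fin (Λ + 1)) (Fin (Λ + 1)) ℂ) : Op Λ :=
  (Matrix.single (0 : Fin 2) (1 : Fin 2) (1 : ℂ)) ⊗ₖ B
    + (Matrix.single (1 : Fin 2) (0 : Fin 2) (1 : ℂ)) ⊗ₖ C

/-- `𝒯_k(t) = exp (i t [[0, (a†)^k], [a^k, 0]])`. -/
def powerUnitary (Λ k : ℕ) (t : ℝ) : Op Λ :=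
  NormedSpace.exp ((Complex.I * (t : ℂ)) • offDiag (creation Λ ^ k) (annihilation Λ ^ k))

/-- `𝒫_k(t) = exp (i t [[0, (a†)^k |0⟩⟨0|], [|0⟩⟨0| a^k, 0]])`. -/
def prepUnitary (Λ k : ℕ) (t : ℝ) : Op Λ :=
  NormedSpace.exp ((Complex.I * (t : ℂ)) •
    offDiag (creation Λ ^ k * vacuumProj Λ) (vacuumProj Λ * annihilation Λ ^ k))

/-- The vacuum phase flip `R_{Z0} = 1 ⊗ (1 - 2 |0⟩⟨0|)`. -/
def phaseFlip (Λ : ℕ) : Op Λ :=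
  (1 : Matrix (Fin 2) (Fin 2) ℂ) ⊗ₖ (1 - (2 : ℂ) • vacuumProj Λ)

/-- Elementary steps of a preparation circuit: one call of the available `𝒯_k` subroutine with
time parameter `s`, or one vacuum phase flip. -/
inductive Gate : Type
  | call (s : ℝ)
  | flip

/-- A circuit, written as an operator product from left to right. -/
abbrev Circuit : Type := List Gate

/-- The operator of a gate, when the subroutine called with parameter `s` performs `T s`. -/
def Gate.eval {Λ : ℕ} (T : ℝ → Op Λ) : Gate → Op Λ
  | .call s => T s
  | .flip => phaseFlip Λ

/-- The operator of a circuit. -/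
def Circuit.eval {Λ : ℕ} (T : ℝ → Op Λ) (c : Circuit) : Op Λ := (c.map (Gate.eval T)).prod

/-- The number of subroutine calls made by a gate. -/
def Gate.cost : Gate → ℕ
  | .call _ => 1
  | .flip => 0

/-- The number of subroutine calls made by a circuit. -/
def Circuit.cost (c : Circuit) : ℕ := (c.map Gate.cost).sum

/-- Suzuki's coefficient `p_k = (4 - 4^{1/(2k-1)})⁻¹`. -/
def suzukiCoeff (k : ℕ) : ℝ := (4 - (4 : ℝ) ^ (1 / (2 * (k : ℝ) - 1)))⁻¹

/-- The two-term Trotter-Suzuki formula `Trotter_{2q}` (for `q ≥ 1`) at time `t`, applied to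
circuits `U₁ s`, `U₂ s` that stand in for `exp (s A₁)`, `exp (s A₂)`. -/
def trotter (U₁ U₂ : ℝ → Circuit) : ℕ → ℝ → Circuit
  | 0, _ => []
  | 1, t => U₁ (t / 2) ++ U₂ (t / 2) ++ U₂ (t / 2) ++ U₁ (t / 2)
  | q + 2, t =>
      let S : ℝ → Circuit := trotter U₁ U₂ (q + 1)
      let c : ℝ := suzukiCoeff (q + 2)
      S (c * t) ++ S (c * t) ++ S ((1 - 4 * c) * t) ++ S (c * t) ++ S (c * t)

/-- `Trotter_{2q}` applied to `𝒯̃(t/2)` and `R_{Z0} 𝒯̃(-t/2) R_{Z0}`. -/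
def prepCircuit (q : ℕ) (t : ℝ) : Circuit :=
  trotter (fun s => [Gate.call (s / 2)])
    (fun s => [Gate.flip, Gate.call (-(s / 2)), Gate.flip]) q t

/-- The index `q = max (⌈(p - 1) / 2⌉, 1)` used for an order `p` approximation. -/
def trotterIndex (p : ℝ) : ℕ := max ⌈(p - 1) / 2⌉₊ 1

/-- The scale `Λ^{k/2} |t|` in which errors are measured. -/
def errScale (Λ k : ℕ) (t : ℝ) : ℝ := (Λ : ℝ) ^ ((k : ℝ) / 2) * |t|

end FockPrep

end

/-! Write `H` for the generator of `powerUnitary`, `R` for the phase flip and `x` for `errScale Λ k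
t`. Part (1): the generator of `prepUnitary` exchanges |1,0⟩ and |0,k⟩ up to the factor √k! and
kills |1,b⟩ for b ≠ 0. So the evolution rotates one plane by the angle t√k!, and the prescribed
times make this angle π/2 + nπ.

Part (2): since a^k|0⟩ = 0 for k ≥ 1, conjugation by `R` reverses exactly the part of `H` that
passes through the vacuum, and `H - R H R` is twice the generator of `prepUnitary`
(`powerGen_sub_phaseFlip_conj`). Thus `prepUnitary` is exp(t(A₁ + A₂)) with A₁ = iH/2 and A₂ = -R A₁
R, and each exp(s Aⱼ) costs one call. The error splits in two. With exact calls it is the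
Trotter-Suzuki error, of order x^(2q+1) with 2q+1 ≥ p. Replacing exact calls by approximate ones
costs order x^p, by telescoping products whose exact factors are unitary (`ErrorStable`).

The Trotter constants must not depend on Λ and k. The generators, normalised to norm at most 1, are
therefore collected into two elements of one Banach algebra, the bounded families indexed by (Λ, k),
where a single estimate serves every coordinate. -/

namespace FockPrep

open Filter Topology Matrix

/-! ### Order of the Trotter-Suzuki formulas in a Banach algebra -/

section Suzuki

variable {𝔸 : Type*} [NormedRing 𝔸] [NormedAlgebra ℝ 𝔸]

/-- `S t = exp (a t X) + t ^ n g t` near `t = 0`, with `g` analytic and `g 0 = v`. -/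
def HasExpError (n : ℕ) (S : ℝ → 𝔸) (X : 𝔸) (a : ℝ) (v : 𝔸) : Prop :=
  ∃ g : ℝ → 𝔸, AnalyticAt ℝ g 0 ∧ g 0 = v ∧
    ∀ᶠ t in 𝓝 (0 : ℝ), S t = NormedSpace.exp ((a * t) • X) + t ^ n • g t

theorem HasExpError.comp_mul {n : ℕ} {S : ℝ → 𝔸} {X : 𝔸} {a : ℝ} {v : 𝔸}
    (h : HasExpError n S X a v) (c : ℝ) :
    HasExpError n (fun t => S (c * t)) X (a * c) (c ^ n • v) := by
  obtain ⟨g, hg, hv, hS⟩ := h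
  have hc : AnalyticAt ℝ (fun t : ℝ => c * t) 0 := analyticAt_const.mul analyticAt_id
  have ht : Tendsto (fun t : ℝ => c * t) (𝓝 0) (𝓝 0) := by
    simpa using hc.continuousAt.tendsto
  refine ⟨fun t => c ^ n • g (c * t), ?_, by simp [hv], ?_⟩
  · have hg' : AnalyticAt ℝ g ((fun t : ℝ => c * t) 0) := by simpa using hg
    have hgc : AnalyticAt ℝ (fun t : ℝ => g (c * t)) 0 := hg'.comp hc
    have hcn : AnalyticAt ℝ (fun _ : ℝ => c ^ n) 0 := analyticAt_const
    exact hcn.smul hgc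
  · filter_upwards [ht.eventually hS] with t h
    rw [h, mul_pow, smul_smul, mul_assoc, mul_comm (t ^ n)]

theorem HasExpError.succ {n : ℕ} {S : ℝ → 𝔸} {X : 𝔸} {a : ℝ}
    (h : HasExpError n S X a 0) : ∃ v, HasExpError (n + 1) S X a v := by
  obtain ⟨g, hg, hv, hS⟩ := h
  obtain ⟨p, hp⟩ := hg
  refine ⟨_, dslope g 0, ⟨_, hp.has_fpower_series_dslope_fslope⟩, rfl, ?_⟩
  filter_upwards [hS] with t h
  have := sub_smul_dslope g 0 t
  rw [hv, sub_zero, sub_zero] at this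
  rw [h, pow_succ, mul_smul (t ^ n), this]

variable [CompleteSpace 𝔸]

theorem analyticAt_exp_mul_smul (a : ℝ) (X : 𝔸) (t₀ : ℝ) :
    AnalyticAt ℝ (fun t : ℝ => NormedSpace.exp ((a * t) • X)) t₀ := by
  have h : AnalyticAt ℝ (fun t : ℝ => (a * t) • X) t₀ :=
    (analyticAt_const.mul analyticAt_id).smul analyticAt_const
  exact (NormedSpace.exp_analytic (𝕂 := ℝ) _).comp h

theorem exp_add_smul (a b t : ℝ) (X : 𝔸) :
    NormedSpace.exp ((a * t) • X) * NormedSpace.exp ((b * t) • X)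
      = NormedSpace.exp (((a + b) * t) • X) := by
  let _ : NormedAlgebra ℚ 𝔸 := NormedAlgebra.restrictScalars ℚ ℝ 𝔸
  rw [add_mul, add_smul, NormedSpace.exp_add_of_commute]
  exact ((Commute.refl X).smul_left _).smul_right _

/-- Leading coefficients add because both exponentials are 1 at t = 0 and the product of the two
remainders carries an extra t^n, which vanishes there as n ≠ 0. -/
theorem HasExpError.mul {n : ℕ} {S₁ S₂ : ℝ → 𝔸} {X : 𝔸} {a b : ℝ} {v w : 𝔸} (hn : n ≠ 0)
    (h₁ : HasExpError n S₁ X a v) (h₂ : HasExpError n S₂ X b w) :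
    HasExpError n (fun t => S₁ t * S₂ t) X (a + b) (v + w) := by
  obtain ⟨g, hg, hv, hS⟩ := h₁
  obtain ⟨f, hf, hw, hR⟩ := h₂
  have hpow : AnalyticAt ℝ (fun t : ℝ => t ^ n) 0 := analyticAt_id.pow n
  refine ⟨fun t => g t * NormedSpace.exp ((b * t) • X) + NormedSpace.exp ((a * t) • X) * f t
    + t ^ n • (g t * f t), ?_, ?_, ?_⟩
  · exact ((hg.mul (analyticAt_exp_mul_smul b X 0)).add
      ((analyticAt_exp_mul_smul a X 0).mul hf)).add (hpow.smul (hg.mul hf))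
  · simp [hn, hv, hw]
  · filter_upwards [hS, hR] with t h₁ h₂
    rw [h₁, h₂, ← exp_add_smul]
    simp only [add_mul, mul_add, smul_add, smul_mul_assoc, mul_smul_comm, smul_smul]
    abel

/-- For even n the leading coefficient of S(t) S(-t) is v + (-1)^n v = 2v, while the product is
identically 1 and has no error. -/
theorem HasExpError.eq_zero_of_symm {n : ℕ} (hn : n ≠ 0) (he : Even n) {S : ℝ → 𝔸} {X : 𝔸} {v : 𝔸}
    (h : HasExpError n S X 1 v) (hS : ∀ t, S t * S (-t) = 1) : v = 0 := by
  obtain ⟨g, hg, hv, hE⟩ := h.mul hn (h.comp_mul (-1))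
  have hz : ∀ᶠ t in 𝓝[≠] (0 : ℝ), g t = 0 := by
    filter_upwards [hE.filter_mono nhdsWithin_le_nhds, self_mem_nhdsWithin] with t h ht
    have h' : t ^ n • g t = 0 := by simpa [hS] using h
    exact (smul_eq_zero.1 h').resolve_left (pow_ne_zero _ ht)
  have hlim : Tendsto g (𝓝[≠] 0) (𝓝 (g 0)) := hg.continuousAt.tendsto.mono_left nhdsWithin_le_nhds
  have h0 : g 0 = 0 := tendsto_nhds_unique hlim
    (tendsto_const_nhds.congr' (hz.mono fun _ h => h.symm))
  rw [hv, he.neg_one_pow, one_smul, ← two_smul ℝ] at h0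
  exact (smul_eq_zero.1 h0).resolve_left two_ne_zero

/-- The comparison rate is 0, so `X` is arbitrary: exponentials of different generators can be
multiplied under a common `X`, with their first-order terms recorded in `v`. -/
theorem HasExpError.exp_mul_smul (a : ℝ) (A X : 𝔸) :
    HasExpError 1 (fun t => NormedSpace.exp ((a * t) • A)) X 0 (a • A) := by
  set F : ℝ → 𝔸 := fun t => NormedSpace.exp ((a * t) • A) with hF
  obtain ⟨p, hp⟩ := analyticAt_exp_mul_smul a A 0
  refine ⟨dslope F 0, ⟨_, hp.has_fpower_series_dslope_fslope⟩, ?_, ?_⟩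
  · have hd : HasDerivAt F (a • A) 0 := by
      have h1 := hasDerivAt_exp_smul_const (𝕂 := ℝ) A (a * 0)
      have h2 : HasDerivAt (fun t : ℝ => a * t) a 0 := by
        simpa using (hasDerivAt_id (0 : ℝ)).const_mul a
      have h3 := h1.scomp (0 : ℝ) h2
      rw [mul_zero, zero_smul, NormedSpace.exp_zero, one_mul] at h3
      exact h3
    rw [dslope_same, hd.deriv]
  · refine Eventually.of_forall fun t => ?_
    have := sub_smul_dslope F 0 t
    rw [sub_zero] at this
    rw [pow_one, this]
    simp [hF]

theorem HasExpError.of_zero {S : ℝ → 𝔸} {X : 𝔸} (h : HasExpError 1 S X 0 X) :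
    HasExpError 1 S X 1 0 := by
  obtain ⟨g, hg, hv, hS⟩ := h
  obtain ⟨f, hf, hw, hR⟩ := HasExpError.exp_mul_smul 1 X X
  refine ⟨fun t => g t - f t, hg.sub hf, by simp [hv, hw], ?_⟩
  filter_upwards [hS, hR] with t h₁ h₂
  rw [h₁, h₂, smul_sub]
  abel

/-- The Trotter-Suzuki formula `Trotter_{2q}` for operator-valued functions. -/
noncomputable def trotterOp {R : Type*} [Monoid R] (U₁ U₂ : ℝ → R) : ℕ → ℝ → R
  | 0, _ => 1
  | 1, t => U₁ (t / 2) * U₂ (t / 2) * U₂ (t / 2) * U₁ (t / 2)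
  | q + 2, t =>
      let S : ℝ → R := trotterOp U₁ U₂ (q + 1)
      let c : ℝ := suzukiCoeff (q + 2)
      S (c * t) * S (c * t) * S ((1 - 4 * c) * t) * S (c * t) * S (c * t)

theorem trotterOp_mul_neg {R : Type*} [Monoid R] {U₁ U₂ : ℝ → R} (h₁ : ∀ s, U₁ s * U₁ (-s) = 1)
    (h₂ : ∀ s, U₂ s * U₂ (-s) = 1) : ∀ (q : ℕ) (t : ℝ),
      trotterOp U₁ U₂ q t * trotterOp U₁ U₂ q (-t) = 1
  | 0, _ => by simp [trotterOp]
  | 1, t => by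
      have h₁' := fun (s : ℝ) (x : R) => (mul_assoc (U₁ s) (U₁ (-s)) x).symm.trans (by rw [h₁, one_mul])
      have h₂' := fun (s : ℝ) (x : R) => (mul_assoc (U₂ s) (U₂ (-s)) x).symm.trans (by rw [h₂, one_mul])
      simp only [trotterOp, neg_div, mul_assoc, h₁', h₂', h₁]
  | q + 2, t => by
      have ih := trotterOp_mul_neg h₁ h₂ (q + 1)
      have ih' := fun (s : ℝ) (x : R) => (mul_assoc (trotterOp U₁ U₂ (q + 1) s)
        (trotterOp U₁ U₂ (q + 1) (-s)) x).symm.trans (by rw [ih, one_mul])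
      simp only [trotterOp, mul_neg, mul_assoc, ih', ih]

/-- With r^(2q+3) = 4 and c = 1/(4 - r), one has 1 - 4c = -rc, whose odd power is -4c^(2q+3). -/
theorem suzukiCoeff_spec (q : ℕ) :
    4 * suzukiCoeff (q + 2) ^ (2 * q + 3) + (1 - 4 * suzukiCoeff (q + 2)) ^ (2 * q + 3) = 0 := by
  set r : ℝ := (4 : ℝ) ^ (1 / (2 * ((q + 2 : ℕ) : ℝ) - 1)) with hr
  have hn : (2 * ((q + 2 : ℕ) : ℝ) - 1) = ((2 * q + 3 : ℕ) : ℝ) := by push_cast; ring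
  have hrn : r ^ (2 * q + 3) = 4 := by
    rw [hr, hn, one_div]
    exact Real.rpow_inv_natCast_pow (by norm_num) (by omega)
  have hr4 : 4 - r ≠ 0 := by
    intro h
    have h4 : r = 4 := by linarith
    rw [h4] at hrn
    have : (4 : ℝ) ^ 1 < 4 ^ (2 * q + 3) := pow_lt_pow_right₀ (by norm_num) (by omega)
    linarith
  have hc : suzukiCoeff (q + 2) = (4 - r)⁻¹ := rfl
  have h1 : 1 - 4 * suzukiCoeff (q + 2) = -(r * suzukiCoeff (q + 2)) := by
    rw [hc]; field_simp; ring
  have hodd : Odd (2 * q + 3) := ⟨q + 1, by ring⟩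
  rw [h1, hodd.neg_pow, mul_pow, hrn]
  ring

theorem hasExpError_trotterOp (A₁ A₂ : 𝔸) : ∀ q : ℕ, ∃ v,
    HasExpError (2 * q + 3)
      (trotterOp (fun s => NormedSpace.exp (s • A₁)) (fun s => NormedSpace.exp (s • A₂)) (q + 1))
      (A₁ + A₂) 1 v := by
  have hinv : ∀ (A : 𝔸) (s : ℝ), NormedSpace.exp (s • A) * NormedSpace.exp ((-s) • A) = 1 := by
    intro A s
    simpa using exp_add_smul 1 (-1) s A
  have hsymm := trotterOp_mul_neg (hinv A₁) (hinv A₂)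
  intro q
  -- An error of even order improves by one for free: time symmetry annihilates its leading
  -- coefficient.
  suffices h : ∃ v, HasExpError (2 * q + 2) (trotterOp (fun s => NormedSpace.exp (s • A₁))
      (fun s => NormedSpace.exp (s • A₂)) (q + 1)) (A₁ + A₂) 1 v by
    obtain ⟨v, hv⟩ := h
    have := hv.eq_zero_of_symm (by omega) ⟨q + 1, by ring⟩ (hsymm _)
    subst this
    exact hv.succ
  induction q with
  | zero =>
    have e := fun A : 𝔸 => HasExpError.exp_mul_smul (1 / 2) A (A₁ + A₂)
    have h := (((e A₁).mul one_ne_zero (e A₂)).mul one_ne_zero (e A₂)).mul one_ne_zero (e A₁)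
    have hv : (1 / 2 : ℝ) • A₁ + (1 / 2 : ℝ) • A₂ + (1 / 2 : ℝ) • A₂ + (1 / 2 : ℝ) • A₁ = A₁ + A₂ := by
      module
    rw [hv, add_zero, add_zero, add_zero] at h
    have hS : trotterOp (fun s => NormedSpace.exp (s • A₁)) (fun s => NormedSpace.exp (s • A₂)) (0 + 1)
        = fun t : ℝ => NormedSpace.exp ((1 / 2 * t) • A₁) * NormedSpace.exp ((1 / 2 * t) • A₂)
          * NormedSpace.exp ((1 / 2 * t) • A₂) * NormedSpace.exp ((1 / 2 * t) • A₁) := by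
      funext t
      simp only [trotterOp, one_div_mul_eq_div]
    rw [hS]
    exact h.of_zero.succ
  | succ q ih =>
    obtain ⟨w, hw⟩ := ih
    have := hw.eq_zero_of_symm (by omega) ⟨q + 1, by ring⟩ (hsymm _)
    subst this
    obtain ⟨v, hv⟩ := hw.succ
    set c := suzukiCoeff (q + 2) with hc
    have hn : 2 * q + 2 + 1 ≠ 0 := by omega
    have h := ((((hv.comp_mul c).mul hn (hv.comp_mul c)).mul hn (hv.comp_mul (1 - 4 * c))).mul hn
      (hv.comp_mul c)).mul hn (hv.comp_mul c)
    have ha : 1 * c + 1 * c + 1 * (1 - 4 * c) + 1 * c + 1 * c = 1 := by ring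
    -- The five rescaled copies have odd-order leading terms that cancel; this is what determines
    -- Suzuki's coefficient.
    have hz : c ^ (2 * q + 2 + 1) • v + c ^ (2 * q + 2 + 1) • v + (1 - 4 * c) ^ (2 * q + 2 + 1) • v
        + c ^ (2 * q + 2 + 1) • v + c ^ (2 * q + 2 + 1) • v = 0 := by
      rw [← add_smul, ← add_smul, ← add_smul, ← add_smul]
      convert zero_smul ℝ v using 2
      rw [← suzukiCoeff_spec q]
      ring
    rw [ha, hz] at h
    exact h.succ

theorem norm_trotterOp_sub_exp_le (A₁ A₂ : 𝔸) (q : ℕ) : ∃ C δ : ℝ, 0 < C ∧ 0 < δ ∧ ∀ t : ℝ, |t| ≤ δ →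
    ‖trotterOp (fun s => NormedSpace.exp (s • A₁)) (fun s => NormedSpace.exp (s • A₂)) (q + 1) t
      - NormedSpace.exp (t • (A₁ + A₂))‖ ≤ C * |t| ^ (2 * q + 3) := by
  obtain ⟨v, g, hg, hv, hS⟩ := hasExpError_trotterOp A₁ A₂ q
  have hb : ∀ᶠ t in 𝓝 (0 : ℝ), ‖g t‖ < ‖v‖ + 1 := by
    refine hg.continuousAt.norm.eventually_lt continuousAt_const ?_
    rw [hv]; linarith
  obtain ⟨δ, hδ, h⟩ := Metric.eventually_nhds_iff.1 (hS.and hb)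
  refine ⟨‖v‖ + 1, δ / 2, by positivity, by positivity, fun t ht => ?_⟩
  obtain ⟨h1, h2⟩ := h (y := t) (by rw [Real.dist_0_eq_abs]; linarith)
  rw [h1, one_mul, add_sub_cancel_left, norm_smul, norm_pow, Real.norm_eq_abs, mul_comm]
  gcongr

end Suzuki

theorem map_trotterOp {R R' : Type*} [Monoid R] [Monoid R'] (φ : R →* R') (U₁ U₂ : ℝ → R) :
    ∀ (q : ℕ) (t : ℝ),
      φ (trotterOp U₁ U₂ q t) = trotterOp (fun s => φ (U₁ s)) (fun s => φ (U₂ s)) q t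
  | 0, _ => map_one φ
  | 1, t => by simp only [trotterOp, map_mul]
  | q + 2, t => by simp only [trotterOp, map_mul, map_trotterOp φ U₁ U₂ (q + 1)]

theorem trotterOp_comp_mul {R : Type*} [Monoid R] (U₁ U₂ : ℝ → R) (M : ℝ) :
    ∀ (q : ℕ) (t : ℝ),
      trotterOp (fun s => U₁ (M * s)) (fun s => U₂ (M * s)) q t = trotterOp U₁ U₂ q (M * t)
  | 0, _ => rfl
  | 1, t => by simp only [trotterOp, mul_div_assoc]
  | q + 2, t => by
      simp only [trotterOp, trotterOp_comp_mul U₁ U₂ M (q + 1), mul_left_comm M]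

/-! ### Uniform constants over families of algebras -/

section Uniform

variable {ι : Type*} {B : ι → Type*} [∀ i, NormedRing (B i)] [∀ i, NormOneClass (B i)]

/-- Evaluation at an index, on the algebra of bounded families. -/
def boundedEval (i : ι) : lp B ⊤ →+* B i where
  toFun f := f i
  map_one' := by simp [lp.infty_coeFn_one]
  map_mul' f g := by simp [lp.infty_coeFn_mul]
  map_zero' := rfl
  map_add' _ _ := rfl

variable [∀ i, NormedAlgebra ℝ (B i)] [∀ i, CompleteSpace (B i)]

theorem boundedEval_exp (i : ι) (f : lp B ⊤) :
    boundedEval i (NormedSpace.exp f) = NormedSpace.exp (f i) := by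
  let _ : NormedAlgebra ℚ (lp B ⊤) := NormedAlgebra.restrictScalars ℚ ℝ _
  let _ : NormedAlgebra ℚ (B i) := NormedAlgebra.restrictScalars ℚ ℝ _
  refine NormedSpace.map_exp (boundedEval i) ?_ f
  exact (lp.evalCLM ℝ B ⊤ i).continuous

/-- Evaluation at an index is a continuous ring homomorphism that does not increase the norm, so the
estimate in the algebra of bounded families passes to every index with the same constants. -/
theorem norm_trotterOp_sub_exp_le_uniform (q : ℕ) (A₁ A₂ : ∀ i, B i)
    (h₁ : ∀ i, ‖A₁ i‖ ≤ 1) (h₂ : ∀ i, ‖A₂ i‖ ≤ 1) :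
    ∃ C δ : ℝ, 0 < C ∧ 0 < δ ∧ ∀ (i : ι) (t : ℝ), |t| ≤ δ →
      ‖trotterOp (fun s => NormedSpace.exp (s • A₁ i)) (fun s => NormedSpace.exp (s • A₂ i)) (q + 1) t
        - NormedSpace.exp (t • (A₁ i + A₂ i))‖ ≤ C * |t| ^ (2 * q + 3) := by
  have hb : ∀ A : ∀ i, B i, (∀ i, ‖A i‖ ≤ 1) → Memℓp A ⊤ := fun A hA =>
    memℓp_infty ⟨1, by rintro _ ⟨i, rfl⟩; exact hA i⟩
  let F₁ : lp B ⊤ := ⟨A₁, hb A₁ h₁⟩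
  let F₂ : lp B ⊤ := ⟨A₂, hb A₂ h₂⟩
  obtain ⟨C, δ, hC, hδ, h⟩ := norm_trotterOp_sub_exp_le F₁ F₂ q
  refine ⟨C, δ, hC, hδ, fun i t ht => le_trans ?_ (h t ht)⟩
  refine le_trans (le_of_eq ?_) (lp.norm_apply_le_norm ENNReal.top_ne_zero _ i)
  have hT := map_trotterOp (boundedEval (B := B) i : lp B ⊤ →* B i)
    (fun s => NormedSpace.exp (s • F₁)) (fun s => NormedSpace.exp (s • F₂)) (q + 1) t
  have hE := boundedEval_exp i (t • (F₁ + F₂))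
  simp only [MonoidHom.coe_coe, boundedEval_exp] at hT
  exact congrArg₂ (fun x y => ‖x - y‖) hT.symm hE.symm

end Uniform

/-! ### Cost and evaluation of circuits; unitarity -/

theorem cost_append (c d : Circuit) : (c ++ d : Circuit).cost = c.cost + d.cost := by
  simp [Circuit.cost]

theorem cost_trotter_le {U₁ U₂ : ℝ → Circuit} (h₁ : ∀ s, (U₁ s).cost ≤ 1)
    (h₂ : ∀ s, (U₂ s).cost ≤ 1) : ∀ (q : ℕ) (t : ℝ), (trotter U₁ U₂ (q + 1) t).cost ≤ 4 * 5 ^ q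
  | 0, t => by
      have := h₁ (t / 2)
      have := h₂ (t / 2)
      simp only [trotter, cost_append]
      omega
  | q + 1, t => by
      have h := cost_trotter_le h₁ h₂ q
      have := h (suzukiCoeff (q + 2) * t)
      have := h ((1 - 4 * suzukiCoeff (q + 2)) * t)
      simp only [trotter, cost_append]
      rw [pow_succ]
      omega

theorem eval_append {Λ : ℕ} (T : ℝ → Op Λ) (c d : Circuit) :
    (c ++ d : Circuit).eval T = c.eval T * d.eval T := by
  simp [Circuit.eval]

theorem eval_trotter {Λ : ℕ} (T : ℝ → Op Λ) (U₁ U₂ : ℝ → Circuit) : ∀ (q : ℕ) (t : ℝ),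
    (trotter U₁ U₂ q t).eval T
      = trotterOp (fun s => (U₁ s).eval T) (fun s => (U₂ s).eval T) q t
  | 0, _ => by simp [trotter, trotterOp, Circuit.eval]
  | 1, t => by simp only [trotter, trotterOp, eval_append]
  | q + 2, t => by simp only [trotter, trotterOp, eval_append, eval_trotter T U₁ U₂ (q + 1)]

theorem vacuumProj_mul_self (Λ : ℕ) : vacuumProj Λ * vacuumProj Λ = vacuumProj Λ := by
  simp [vacuumProj]

theorem conjTranspose_vacuumProj (Λ : ℕ) : (vacuumProj Λ)ᴴ = vacuumProj Λ := by
  simp [vacuumProj]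

theorem phaseFlip_mul_self (Λ : ℕ) : phaseFlip Λ * phaseFlip Λ = 1 := by
  have h : (1 - (2 : ℂ) • vacuumProj Λ) * (1 - (2 : ℂ) • vacuumProj Λ) = 1 := by
    simp only [sub_mul, mul_sub, one_mul, mul_one, smul_mul_assoc, mul_smul_comm,
      vacuumProj_mul_self]
    module
  rw [phaseFlip, ← Matrix.mul_kronecker_mul, h, one_mul, Matrix.one_kronecker_one]

theorem conjTranspose_phaseFlip (Λ : ℕ) : (phaseFlip Λ)ᴴ = phaseFlip Λ := by
  simp [phaseFlip, Matrix.conjTranspose_kronecker, conjTranspose_vacuumProj]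

theorem phaseFlip_mem_unitaryGroup (Λ : ℕ) :
    phaseFlip Λ ∈ unitaryGroup (Fin 2 × Fin (Λ + 1)) ℂ := by
  rw [mem_unitaryGroup_iff, star_eq_conjTranspose, conjTranspose_phaseFlip, phaseFlip_mul_self]

theorem eval_mem_unitaryGroup {Λ : ℕ} {T : ℝ → Op Λ}
    (hT : ∀ s, T s ∈ unitaryGroup (Fin 2 × Fin (Λ + 1)) ℂ) (c : Circuit) :
    c.eval T ∈ unitaryGroup (Fin 2 × Fin (Λ + 1)) ℂ := by
  refine list_prod_mem fun x hx => ?_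
  obtain ⟨g, -, rfl⟩ := List.mem_map.1 hx
  cases g with
  | call s => exact hT s
  | flip => exact phaseFlip_mem_unitaryGroup Λ

theorem conjTranspose_offDiag {Λ : ℕ} (B C : Matrix (Fin (Λ + 1)) (Fin (Λ + 1)) ℂ) :
    (offDiag B C)ᴴ = offDiag Cᴴ Bᴴ := by
  simp [offDiag, Matrix.conjTranspose_kronecker, add_comm]

theorem exp_I_smul_mem_unitaryGroup {Λ : ℕ} {H : Op Λ} (hH : Hᴴ = H) (t : ℝ) :
    NormedSpace.exp ((Complex.I * (t : ℂ)) • H) ∈ unitaryGroup (Fin 2 × Fin (Λ + 1)) ℂ := by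
  let _ : NormedAlgebra ℚ (Op Λ) := NormedAlgebra.restrictScalars ℚ ℂ _
  refine NormedSpace.exp_mem_unitary_of_mem_skewAdjoint ?_
  rw [skewAdjoint.mem_iff, star_smul, star_eq_conjTranspose, hH]
  simp

theorem powerUnitary_mem_unitaryGroup (Λ k : ℕ) (t : ℝ) :
    powerUnitary Λ k t ∈ unitaryGroup (Fin 2 × Fin (Λ + 1)) ℂ := by
  refine exp_I_smul_mem_unitaryGroup ?_ t
  rw [conjTranspose_offDiag]
  simp [creation, Matrix.conjTranspose_pow]

theorem prepUnitary_mem_unitaryGroup (Λ k : ℕ) (t : ℝ) :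
    prepUnitary Λ k t ∈ unitaryGroup (Fin 2 × Fin (Λ + 1)) ℂ := by
  refine exp_I_smul_mem_unitaryGroup ?_ t
  rw [conjTranspose_offDiag]
  simp [creation, Matrix.conjTranspose_pow, conjTranspose_vacuumProj]

theorem norm_of_mem_unitaryGroup {Λ : ℕ} {U : Op Λ}
    (hU : U ∈ unitaryGroup (Fin 2 × Fin (Λ + 1)) ℂ) : ‖U‖ = 1 :=
  CStarRing.norm_of_mem_unitary hU

/-! ### Propagation of subroutine errors -/

theorem errScale_nonneg (Λ k : ℕ) (t : ℝ) : 0 ≤ errScale Λ k t := by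
  unfold errScale; positivity

theorem errScale_mul (Λ k : ℕ) (r t : ℝ) : errScale Λ k (r * t) = |r| * errScale Λ k t := by
  unfold errScale; rw [abs_mul]; ring

/-- Errors of order `p` in the subroutine cause errors of order `p` in the circuits `c t`,
uniformly in `Λ` and `k`. -/
def ErrorStable (p : ℝ) (c : ℝ → Circuit) : Prop :=
  ∀ C₀ δ₀ : ℝ, 0 < C₀ → 0 < δ₀ → ∃ C δ : ℝ, 0 < C ∧ 0 < δ ∧ ∀ (Λ k : ℕ) (T : ℝ → Op Λ),
    (∀ s : ℝ, errScale Λ k s ≤ δ₀ → ‖T s - powerUnitary Λ k s‖ ≤ C₀ * errScale Λ k s ^ p) →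
    ∀ t : ℝ, errScale Λ k t ≤ δ →
      ‖(c t).eval T - (c t).eval (powerUnitary Λ k)‖ ≤ C * errScale Λ k t ^ p

theorem ErrorStable.call (p : ℝ) : ErrorStable p fun s => [Gate.call s] := by
  intro C₀ δ₀ hC hδ
  refine ⟨C₀, δ₀, hC, hδ, fun Λ k T hT t ht => ?_⟩
  simpa [Circuit.eval, Gate.eval] using hT t ht

theorem ErrorStable.flip (p : ℝ) : ErrorStable p fun _ => [Gate.flip] := by
  intro C₀ δ₀ hC hδ
  refine ⟨1, 1, one_pos, one_pos, fun Λ k T hT t ht => ?_⟩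
  have := errScale_nonneg Λ k t
  simp only [Circuit.eval, Gate.eval, List.map_cons, List.map_nil, sub_self, norm_zero]
  positivity

theorem ErrorStable.comp_mul {p : ℝ} (hp : 0 ≤ p) {c : ℝ → Circuit} (h : ErrorStable p c) (r : ℝ) :
    ErrorStable p fun t => c (r * t) := by
  intro C₀ δ₀ hC₀ hδ₀
  obtain ⟨C, δ, hC, hδ, h⟩ := h C₀ δ₀ hC₀ hδ₀
  -- `|r| + 1` in place of `|r|` keeps the radius meaningful when r = 0.
  refine ⟨C * (|r| + 1) ^ p, δ / (|r| + 1), by positivity, by positivity, fun Λ k T hT t ht => ?_⟩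
  have h0 := errScale_nonneg Λ k t
  have hle : errScale Λ k (r * t) ≤ (|r| + 1) * errScale Λ k t := by
    rw [errScale_mul]; nlinarith
  refine (h Λ k T hT (r * t) (hle.trans ?_)).trans ?_
  · rw [le_div_iff₀ (by positivity)] at ht
    linarith
  · rw [mul_assoc, ← Real.mul_rpow (by positivity) h0]
    have := errScale_nonneg Λ k (r * t)
    gcongr

/-- Telescoping: XY - X'Y' = (X - X')Y + X'(Y - Y'). Here X' is unitary, and Y is within D ε^p of a
unitary. -/
theorem ErrorStable.append {p : ℝ} (hp : 0 ≤ p) {c d : ℝ → Circuit} (hc : ErrorStable p c)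
    (hd : ErrorStable p d) : ErrorStable p fun t => c t ++ d t := by
  intro C₀ δ₀ hC₀ hδ₀
  obtain ⟨C, δ, hC, hδ, hc⟩ := hc C₀ δ₀ hC₀ hδ₀
  obtain ⟨D, ε, hD, hε, hd⟩ := hd C₀ δ₀ hC₀ hδ₀
  refine ⟨C * (1 + D * ε ^ p) + D, min δ ε, by positivity, lt_min hδ hε, fun Λ k T hT t ht => ?_⟩
  have h1 := hc Λ k T hT t (ht.trans (min_le_left _ _))
  have h2 := hd Λ k T hT t (ht.trans (min_le_right _ _))
  have h0 := errScale_nonneg Λ k t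
  set x := errScale Λ k t
  have hx : x ^ p ≤ ε ^ p := Real.rpow_le_rpow h0 (ht.trans (min_le_right _ _)) hp
  have hx0 : 0 ≤ x ^ p := by positivity
  have n1 := norm_of_mem_unitaryGroup
    (eval_mem_unitaryGroup (powerUnitary_mem_unitaryGroup Λ k) (c t))
  have n2 := norm_of_mem_unitaryGroup
    (eval_mem_unitaryGroup (powerUnitary_mem_unitaryGroup Λ k) (d t))
  rw [eval_append, eval_append]
  set X := (c t).eval T
  set Y := (d t).eval T
  set X' := (c t).eval (powerUnitary Λ k)
  set Y' := (d t).eval (powerUnitary Λ k)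
  have hY : ‖Y‖ ≤ 1 + D * ε ^ p := by
    have : ‖Y‖ ≤ ‖Y'‖ + ‖Y - Y'‖ := by
      simpa using norm_add_le Y' (Y - Y')
    have : D * x ^ p ≤ D * ε ^ p := by gcongr
    linarith
  calc ‖X * Y - X' * Y'‖ = ‖(X - X') * Y + X' * (Y - Y')‖ := by congr 1; noncomm_ring
    _ ≤ ‖X - X'‖ * ‖Y‖ + ‖X'‖ * ‖Y - Y'‖ :=
      (norm_add_le _ _).trans (add_le_add (norm_mul_le _ _) (norm_mul_le _ _))
    _ ≤ (C * x ^ p) * (1 + D * ε ^ p) + 1 * (D * x ^ p) := by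
      rw [n1]; gcongr
    _ = (C * (1 + D * ε ^ p) + D) * x ^ p := by ring

theorem ErrorStable.trotter {p : ℝ} (hp : 0 ≤ p) {U₁ U₂ : ℝ → Circuit} (h₁ : ErrorStable p U₁)
    (h₂ : ErrorStable p U₂) (q : ℕ) : ErrorStable p (trotter U₁ U₂ (q + 1)) := by
  induction q with
  | zero =>
    have k₁ := h₁.comp_mul hp (1 / 2)
    have k₂ := h₂.comp_mul hp (1 / 2)
    simp only [one_div_mul_eq_div] at k₁ k₂
    exact ((k₁.append hp k₂).append hp k₂).append hp k₁
  | succ q ih =>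
    have a := ih.comp_mul hp (suzukiCoeff (q + 2))
    have b := ih.comp_mul hp (1 - 4 * suzukiCoeff (q + 2))
    exact (((a.append hp a).append hp b).append hp a).append hp a

theorem errorStable_prepCircuit {p : ℝ} (hp : 0 ≤ p) (q : ℕ) :
    ErrorStable p (prepCircuit (q + 1)) := by
  have h₁ := (ErrorStable.call p).comp_mul hp (1 / 2)
  have h₂ := (ErrorStable.call p).comp_mul hp (-(1 / 2))
  simp only [neg_mul, one_div_mul_eq_div] at h₁ h₂
  exact h₁.trotter hp (((ErrorStable.flip p).append hp h₂).append hp (ErrorStable.flip p)) q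

/-! ### Action of `prepUnitary` on basis states -/

theorem exp_mulVec_of_mulVec_eq_smul {Λ : ℕ} {A : Op Λ} {v : Fin 2 × Fin (Λ + 1) → ℂ} {μ : ℂ}
    (h : A *ᵥ v = μ • v) : NormedSpace.exp A *ᵥ v = Complex.exp μ • v := by
  have hpow : ∀ n : ℕ, A ^ n *ᵥ v = μ ^ n • v := by
    intro n
    induction n with
    | zero => simp
    | succ n ih => rw [pow_succ', ← mulVec_mulVec, ih, mulVec_smul, h, smul_smul, pow_succ]
  have h1 := NormedSpace.exp_series_hasSum_exp' (𝕂 := ℂ) A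
  have h2 := (NormedSpace.exp_series_hasSum_exp' (𝕂 := ℂ) μ).smul_const v
  have h3 : HasSum (fun n : ℕ => ((n.factorial : ℂ)⁻¹ • A ^ n) *ᵥ v) (NormedSpace.exp A *ᵥ v) :=
    h1.map (AddMonoidHom.mk' (fun M : Op Λ => M *ᵥ v) fun M N => add_mulVec M N v)
      (continuous_id.matrix_mulVec continuous_const)
  rw [Complex.exp_eq_exp_ℂ]
  refine h3.unique (h2.congr_fun ?_)
  intro n
  rw [smul_mulVec, hpow, smul_assoc]

theorem creation_pow_apply_zero (Λ k : ℕ) (i : Fin (Λ + 1)) :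
    (creation Λ ^ k) i 0 = if (i : ℕ) = k then ((Real.sqrt k.factorial : ℝ) : ℂ) else 0 := by
  induction k generalizing i with
  | zero =>
    rw [pow_zero, one_apply]
    simp only [Fin.ext_iff, Fin.val_zero, Nat.factorial_zero, Nat.cast_one, Real.sqrt_one,
      Complex.ofReal_one]
  | succ k ih =>
    rw [pow_succ', mul_apply]
    simp only [ih]
    have hc : ∀ j : Fin (Λ + 1), creation Λ i j
        = if (j : ℕ) + 1 = i then ((Real.sqrt (i : ℕ) : ℝ) : ℂ) else 0 := by
      intro j
      simp only [creation, annihilation, conjTranspose_apply, of_apply]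
      split_ifs
      · rw [Complex.star_def, Complex.conj_ofReal]
      · exact star_zero ℂ
    simp only [hc]
    by_cases hi : (i : ℕ) = k + 1
    · rw [Finset.sum_eq_single (⟨k, by omega⟩ : Fin (Λ + 1))]
      · rw [if_pos hi, if_pos hi.symm, if_pos rfl, hi, ← Complex.ofReal_mul,
          ← Real.sqrt_mul (Nat.cast_nonneg _), ← Nat.cast_mul, Nat.factorial_succ]
      · intro j _ hj
        rw [if_neg (fun h => hj (Fin.ext h)), mul_zero]
      · simp
    · rw [if_neg hi]
      refine Finset.sum_eq_zero fun j _ => ?_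
      by_cases h1 : (j : ℕ) = k
      · rw [if_neg (by omega), zero_mul]
      · rw [if_neg h1, mul_zero]

theorem mul_vacuumProj_apply {Λ : ℕ} (M : Matrix (Fin (Λ + 1)) (Fin (Λ + 1)) ℂ)
    (i j : Fin (Λ + 1)) : (M * vacuumProj Λ) i j = if j = 0 then M i 0 else 0 := by
  rcases eq_or_ne j 0 with rfl | hj
  · simp [vacuumProj]
  · simp [vacuumProj, hj]

theorem vacuumProj_mul_annihilation_pow (Λ k : ℕ) :
    vacuumProj Λ * annihilation Λ ^ k = (creation Λ ^ k * vacuumProj Λ)ᴴ := by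
  simp [creation, Matrix.conjTranspose_pow, conjTranspose_vacuumProj]

theorem offDiag_mulVec_ket_one {Λ : ℕ} (B C : Matrix (Fin (Λ + 1)) (Fin (Λ + 1)) ℂ)
    (b : Fin (Λ + 1)) (x : Fin 2 × Fin (Λ + 1)) :
    (offDiag B C *ᵥ ket 1 b) x = if x.1 = 0 then B x.2 b else 0 := by
  obtain ⟨q, m⟩ := x
  fin_cases q <;> simp [ket, offDiag]

theorem offDiag_mulVec_ket_zero {Λ : ℕ} (B C : Matrix (Fin (Λ + 1)) (Fin (Λ + 1)) ℂ)
    (b : Fin (Λ + 1)) (x : Fin 2 × Fin (Λ + 1)) :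
    (offDiag B C *ᵥ ket 0 b) x = if x.1 = 1 then C x.2 b else 0 := by
  obtain ⟨q, m⟩ := x
  fin_cases q <;> simp [ket, offDiag]

theorem prep_generator_mulVec_ket_one_zero {Λ k : ℕ} (hk : k ≤ Λ) :
    offDiag (creation Λ ^ k * vacuumProj Λ) (vacuumProj Λ * annihilation Λ ^ k) *ᵥ ket 1 0
      = ((Real.sqrt k.factorial : ℝ) : ℂ) • ket 0 ⟨k, Nat.lt_succ_of_le hk⟩ := by
  funext x
  rw [offDiag_mulVec_ket_one, mul_vacuumProj_apply, if_pos rfl, creation_pow_apply_zero]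
  obtain ⟨q, m⟩ := x
  simp only [ket, Pi.smul_apply, Pi.single_apply, Prod.mk.injEq, Fin.ext_iff (a := m), smul_eq_mul]
  split_ifs <;> simp_all

theorem prep_generator_mulVec_ket_zero {Λ k : ℕ} (hk : k ≤ Λ) :
    offDiag (creation Λ ^ k * vacuumProj Λ) (vacuumProj Λ * annihilation Λ ^ k) *ᵥ
        ket 0 ⟨k, Nat.lt_succ_of_le hk⟩
      = ((Real.sqrt k.factorial : ℝ) : ℂ) • ket 1 0 := by
  funext x
  rw [offDiag_mulVec_ket_zero, vacuumProj_mul_annihilation_pow, conjTranspose_apply,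
    mul_vacuumProj_apply, creation_pow_apply_zero, if_pos rfl]
  obtain ⟨q, m⟩ := x
  simp only [ket, Pi.smul_apply, Pi.single_apply, Prod.mk.injEq, smul_eq_mul]
  split_ifs <;> simp_all

theorem prepUnitary_mulVec_ket_one_of_ne_zero {Λ : ℕ} (k : ℕ) (t : ℝ) {b : Fin (Λ + 1)}
    (hb : b ≠ 0) : prepUnitary Λ k t *ᵥ ket 1 b = ket 1 b := by
  have h : ((Complex.I * (t : ℂ)) • offDiag (creation Λ ^ k * vacuumProj Λ)
      (vacuumProj Λ * annihilation Λ ^ k)) *ᵥ ket 1 b = (0 : ℂ) • ket 1 b := by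
    rw [smul_mulVec, zero_smul]
    convert smul_zero (Complex.I * (t : ℂ))
    funext x
    rw [offDiag_mulVec_ket_one, mul_vacuumProj_apply, if_neg hb, ite_self, Pi.zero_apply]
  rw [prepUnitary, exp_mulVec_of_mulVec_eq_smul h, Complex.exp_zero, one_smul]

theorem prepUnitary_mulVec_ket_one_zero {Λ k : ℕ} (hk : k ≤ Λ) (t : ℝ) :
    prepUnitary Λ k t *ᵥ ket 1 0
      = ((Real.cos (t * Real.sqrt k.factorial) : ℝ) : ℂ) • ket 1 0
        + (Complex.I * (Real.sin (t * Real.sqrt k.factorial) : ℝ)) •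
          ket 0 ⟨k, Nat.lt_succ_of_le hk⟩ := by
  set u : Fin 2 × Fin (Λ + 1) → ℂ := ket 1 0 with hu
  set w : Fin 2 × Fin (Λ + 1) → ℂ := ket 0 ⟨k, Nat.lt_succ_of_le hk⟩ with hw
  set A : Op Λ := (Complex.I * (t : ℂ)) • offDiag (creation Λ ^ k * vacuumProj Λ)
      (vacuumProj Λ * annihilation Λ ^ k) with hA
  set θ : ℂ := ((t * Real.sqrt k.factorial : ℝ) : ℂ) with hθ
  have hAu : A *ᵥ u = (θ * Complex.I) • w := by
    rw [hA, smul_mulVec, hu, prep_generator_mulVec_ket_one_zero hk, smul_smul, hθ]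
    congr 1
    push_cast
    ring
  have hAw : A *ᵥ w = (θ * Complex.I) • u := by
    rw [hA, smul_mulVec, hw, prep_generator_mulVec_ket_zero hk, smul_smul, hθ]
    congr 1
    push_cast
    ring
  -- `A` exchanges `u` and `w` up to the factor iθ, so u ± w are eigenvectors with eigenvalues ±iθ.
  have hp : A *ᵥ (u + w) = (θ * Complex.I) • (u + w) := by
    rw [mulVec_add, hAu, hAw]
    module
  have hm : A *ᵥ (u - w) = (-θ * Complex.I) • (u - w) := by
    rw [mulVec_sub, hAu, hAw]
    module
  have hsplit : u = (1 / 2 : ℂ) • (u + w) + (1 / 2 : ℂ) • (u - w) := by module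
  have hE : prepUnitary Λ k t = NormedSpace.exp A := rfl
  rw [hE]
  conv_lhs => rw [hsplit]
  rw [mulVec_add, mulVec_smul, mulVec_smul, exp_mulVec_of_mulVec_eq_smul hp,
    exp_mulVec_of_mulVec_eq_smul hm, Complex.ofReal_cos, Complex.ofReal_sin, ← hθ, Complex.exp_mul_I,
    Complex.exp_mul_I, Complex.cos_neg, Complex.sin_neg]
  module

theorem prepUnitary_mulVec_ket_one_zero_of_odd {Λ k : ℕ} (hk : k ≤ Λ) (n : ℕ) {t : ℝ}
    (ht : t = (2 * (n : ℝ) + 1) * (Real.pi / (2 * Real.sqrt k.factorial))) :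
    prepUnitary Λ k t *ᵥ ket 1 0
      = (Complex.I * (-1) ^ n) • ket 0 ⟨k, Nat.lt_succ_of_le hk⟩ := by
  have hs : 0 < Real.sqrt k.factorial := Real.sqrt_pos.2 (by exact_mod_cast k.factorial_pos)
  have hθ : t * Real.sqrt k.factorial = Real.pi / 2 + n * Real.pi := by
    rw [ht]; field_simp; ring
  rw [prepUnitary_mulVec_ket_one_zero hk, hθ, Real.cos_add_nat_mul_pi, Real.sin_add_nat_mul_pi,
    Real.cos_pi_div_two, Real.sin_pi_div_two]
  simp

/-! ### Norms of the generators -/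

theorem norm_annihilation_le (Λ : ℕ) : ‖annihilation Λ‖ ≤ Real.sqrt Λ := by
  -- The number operator is diagonal with entries at most Λ; the C*-identity turns this into the
  -- norm bound.
  have hd : (annihilation Λ)ᴴ * annihilation Λ
      = diagonal fun n : Fin (Λ + 1) => (((n : ℕ) : ℝ) : ℂ) := by
    ext i j
    rw [mul_apply]
    by_cases hi : (i : ℕ) = 0
    · rw [Finset.sum_eq_zero]
      · rw [diagonal_apply]
        split_ifs <;> simp [hi]
      · intro m _
        simp [annihilation, hi]
    · rw [Finset.sum_eq_single (⟨i - 1, by omega⟩ : Fin (Λ + 1))]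
      · have h1 : (i : ℕ) - 1 + 1 = i := by omega
        simp only [conjTranspose_apply, annihilation, of_apply, h1, if_true, diagonal_apply,
          ← Fin.ext_iff]
        split_ifs with hij
        · subst hij
          rw [Complex.star_def, Complex.conj_ofReal, ← Complex.ofReal_mul,
            Real.mul_self_sqrt (Nat.cast_nonneg _)]
        · simp
      · intro m _ hm
        have : (m : ℕ) + 1 ≠ i := fun h => hm (Fin.ext (by simp; omega))
        simp [annihilation, this]
      · simp
  have hn : ‖annihilation Λ‖ * ‖annihilation Λ‖ ≤ Λ := by
    rw [← l2_opNorm_conjTranspose_mul_self, hd, l2_opNorm_diagonal, pi_norm_le_iff_of_nonneg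
      (Nat.cast_nonneg _)]
    intro i
    rw [Complex.norm_real, Real.norm_natCast]
    exact_mod_cast Nat.lt_succ_iff.1 i.2
  exact Real.le_sqrt_of_sq_le (by rw [sq]; exact hn)

theorem norm_annihilation_pow_le (Λ k : ℕ) :
    ‖annihilation Λ ^ k‖ ≤ (Λ : ℝ) ^ ((k : ℝ) / 2) := by
  calc ‖annihilation Λ ^ k‖ ≤ ‖annihilation Λ‖ ^ k := norm_pow_le _ _
    _ ≤ Real.sqrt Λ ^ k := by gcongr; exact norm_annihilation_le Λ
    _ = (Λ : ℝ) ^ ((k : ℝ) / 2) := by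
      rw [Real.sqrt_eq_rpow, ← Real.rpow_natCast, ← Real.rpow_mul (Nat.cast_nonneg _)]
      congr 1
      ring

/-- The embedding `B ↦ 1 ⊗ B` of operators on the mode. -/
noncomputable def oneKronecker (Λ : ℕ) : Matrix (Fin (Λ + 1)) (Fin (Λ + 1)) ℂ →⋆ₙₐ[ℂ] Op Λ where
  toFun B := (1 : Matrix (Fin 2) (Fin 2) ℂ) ⊗ₖ B
  map_smul' c B := Matrix.kronecker_smul c _ B
  map_zero' := Matrix.kronecker_zero _
  map_add' B C := Matrix.kronecker_add _ B C
  map_mul' B C := by rw [← Matrix.mul_kronecker_mul, one_mul]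
  map_star' B := by
    rw [star_eq_conjTranspose, star_eq_conjTranspose, Matrix.conjTranspose_kronecker,
      conjTranspose_one]

/-- The embedding `A ↦ A ⊗ 1` of operators on the qubit. -/
noncomputable def kroneckerOne (Λ : ℕ) : Matrix (Fin 2) (Fin 2) ℂ →⋆ₙₐ[ℂ] Op Λ where
  toFun A := A ⊗ₖ (1 : Matrix (Fin (Λ + 1)) (Fin (Λ + 1)) ℂ)
  map_smul' c A := Matrix.smul_kronecker c A _
  map_zero' := Matrix.zero_kronecker _
  map_add' A B := Matrix.add_kronecker A B _
  map_mul' A B := by rw [← Matrix.mul_kronecker_mul, one_mul]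
  map_star' A := by
    rw [star_eq_conjTranspose, star_eq_conjTranspose, Matrix.conjTranspose_kronecker,
      conjTranspose_one]

/-- A ⊗ B = (A ⊗ 1)(1 ⊗ B), and star homomorphisms of C*-algebras are contractive. -/
theorem norm_kronecker_le {Λ : ℕ} (A : Matrix (Fin 2) (Fin 2) ℂ)
    (B : Matrix (Fin (Λ + 1)) (Fin (Λ + 1)) ℂ) : ‖A ⊗ₖ B‖ ≤ ‖A‖ * ‖B‖ := by
  have h : A ⊗ₖ B = kroneckerOne Λ A * oneKronecker Λ B := by
    change _ = (A ⊗ₖ 1) * (1 ⊗ₖ B)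
    rw [← Matrix.mul_kronecker_mul, one_mul, mul_one]
  rw [h]
  refine (norm_mul_le _ _).trans ?_
  gcongr
  · exact NonUnitalStarAlgHom.norm_apply_le (kroneckerOne Λ) A
  · exact NonUnitalStarAlgHom.norm_apply_le (oneKronecker Λ) B

/-- A bound for the norms of the qubit factors of `offDiag`. -/
noncomputable def qubitBound : ℝ :=
  1 + ‖Matrix.single (0 : Fin 2) (1 : Fin 2) (1 : ℂ)‖ + ‖Matrix.single (1 : Fin 2) (0 : Fin 2) (1 : ℂ)‖

theorem qubitBound_pos : 0 < qubitBound := by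
  unfold qubitBound; positivity

theorem norm_offDiag_le {Λ : ℕ} {B C : Matrix (Fin (Λ + 1)) (Fin (Λ + 1)) ℂ} {x : ℝ}
    (hB : ‖B‖ ≤ x) (hC : ‖C‖ ≤ x) : ‖offDiag B C‖ ≤ qubitBound * x := by
  have hx : 0 ≤ x := (norm_nonneg B).trans hB
  calc ‖offDiag B C‖ ≤ ‖Matrix.single (0 : Fin 2) (1 : Fin 2) (1 : ℂ)‖ * ‖B‖
        + ‖Matrix.single (1 : Fin 2) (0 : Fin 2) (1 : ℂ)‖ * ‖C‖ :=
      (norm_add_le _ _).trans (add_le_add (norm_kronecker_le _ _) (norm_kronecker_le _ _))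
    _ ≤ ‖Matrix.single (0 : Fin 2) (1 : Fin 2) (1 : ℂ)‖ * x
        + ‖Matrix.single (1 : Fin 2) (0 : Fin 2) (1 : ℂ)‖ * x := by gcongr
    _ ≤ qubitBound * x := by unfold qubitBound; nlinarith

/-- The generator `[[0, (a†)^k], [a^k, 0]]`. -/
noncomputable def powerGen (Λ k : ℕ) : Op Λ := offDiag (creation Λ ^ k) (annihilation Λ ^ k)

theorem norm_powerGen_le (Λ k : ℕ) : ‖powerGen Λ k‖ ≤ qubitBound * (Λ : ℝ) ^ ((k : ℝ) / 2) := by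
  refine norm_offDiag_le ?_ (norm_annihilation_pow_le Λ k)
  rw [creation, ← Matrix.conjTranspose_pow, l2_opNorm_conjTranspose]
  exact norm_annihilation_pow_le Λ k

/-! ### The preparation generator as a sum of two conjugate generators -/

theorem annihilation_mul_vacuumProj (Λ : ℕ) : annihilation Λ * vacuumProj Λ = 0 := by
  ext i j
  rcases eq_or_ne j 0 with rfl | hj
  · simp [vacuumProj, annihilation]
  · simp [vacuumProj, hj]

theorem annihilation_pow_mul_vacuumProj (Λ : ℕ) {k : ℕ} (hk : 1 ≤ k) :
    annihilation Λ ^ k * vacuumProj Λ = 0 := by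
  obtain ⟨k, rfl⟩ := Nat.exists_eq_add_of_le' hk
  rw [pow_succ, mul_assoc, annihilation_mul_vacuumProj, mul_zero]

theorem vacuumProj_mul_creation_pow (Λ : ℕ) {k : ℕ} (hk : 1 ≤ k) :
    vacuumProj Λ * creation Λ ^ k = 0 := by
  have h := congrArg conjTranspose (annihilation_pow_mul_vacuumProj Λ hk)
  simpa [creation, Matrix.conjTranspose_pow, conjTranspose_vacuumProj] using h

/-- With P the vacuum projector, P (a†)^k = 0 and a^k P = 0 for k ≥ 1, so in each block only one of
the two flips acts, and it subtracts twice the vacuum part. -/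
theorem powerGen_sub_phaseFlip_conj (Λ : ℕ) {k : ℕ} (hk : 1 ≤ k) :
    powerGen Λ k - phaseFlip Λ * powerGen Λ k * phaseFlip Λ
      = (2 : ℂ) • offDiag (creation Λ ^ k * vacuumProj Λ) (vacuumProj Λ * annihilation Λ ^ k) := by
  have hB : (1 - (2 : ℂ) • vacuumProj Λ) * creation Λ ^ k * (1 - (2 : ℂ) • vacuumProj Λ)
      = creation Λ ^ k - (2 : ℂ) • (creation Λ ^ k * vacuumProj Λ) := by
    rw [sub_mul, smul_mul_assoc, vacuumProj_mul_creation_pow Λ hk, smul_zero, sub_zero, one_mul,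
      mul_sub, mul_one, mul_smul_comm]
  have hC : (1 - (2 : ℂ) • vacuumProj Λ) * annihilation Λ ^ k * (1 - (2 : ℂ) • vacuumProj Λ)
      = annihilation Λ ^ k - (2 : ℂ) • (vacuumProj Λ * annihilation Λ ^ k) := by
    rw [mul_assoc, mul_sub, mul_smul_comm, annihilation_pow_mul_vacuumProj Λ hk, smul_zero, sub_zero,
      mul_one, sub_mul, one_mul, smul_mul_assoc]
  have h : phaseFlip Λ * powerGen Λ k * phaseFlip Λ
      = offDiag (creation Λ ^ k - (2 : ℂ) • (creation Λ ^ k * vacuumProj Λ))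
        (annihilation Λ ^ k - (2 : ℂ) • (vacuumProj Λ * annihilation Λ ^ k)) := by
    simp only [phaseFlip, powerGen, offDiag, mul_add, add_mul, ← Matrix.mul_kronecker_mul, one_mul,
      mul_one, hB, hC]
  rw [h, powerGen]
  ext ⟨q, i⟩ ⟨r, j⟩
  simp only [offDiag, Matrix.sub_apply, Matrix.add_apply, Matrix.smul_apply, kroneckerMap_apply,
    smul_eq_mul]
  ring

/-- The two generators whose exponentials are alternated by the preparation circuit. -/
noncomputable def trotterGen₁ (Λ k : ℕ) : Op Λ := (Complex.I / 2) • powerGen Λ k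

/-- The second generator, the conjugate of `-trotterGen₁` by the phase flip. -/
noncomputable def trotterGen₂ (Λ k : ℕ) : Op Λ := phaseFlip Λ * ((-(Complex.I / 2)) • powerGen Λ k) * phaseFlip Λ

theorem norm_trotterGen₁_le (Λ k : ℕ) :
    ‖trotterGen₁ Λ k‖ ≤ qubitBound * (Λ : ℝ) ^ ((k : ℝ) / 2) := by
  rw [trotterGen₁, norm_smul]
  have := norm_powerGen_le Λ k
  have := norm_nonneg (powerGen Λ k)
  simp only [norm_div, Complex.norm_I, Complex.norm_ofNat]
  linarith

theorem norm_trotterGen₂_le (Λ k : ℕ) :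
    ‖trotterGen₂ Λ k‖ ≤ qubitBound * (Λ : ℝ) ^ ((k : ℝ) / 2) := by
  have hR := norm_of_mem_unitaryGroup (phaseFlip_mem_unitaryGroup Λ)
  have h : ‖trotterGen₂ Λ k‖ ≤ ‖trotterGen₁ Λ k‖ := by
    refine (norm_mul_le _ _).trans ?_
    rw [hR, mul_one]
    refine (norm_mul_le _ _).trans ?_
    rw [hR, one_mul, neg_smul, norm_neg, trotterGen₁]
  exact h.trans (norm_trotterGen₁_le Λ k)

theorem real_smul_op {Λ : ℕ} (t : ℝ) (A : Op Λ) : t • A = (t : ℂ) • A := by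
  ext i j
  simp

theorem prepUnitary_eq_exp (Λ : ℕ) {k : ℕ} (hk : 1 ≤ k) (t : ℝ) :
    prepUnitary Λ k t = NormedSpace.exp (t • (trotterGen₁ Λ k + trotterGen₂ Λ k)) := by
  have h : trotterGen₁ Λ k + trotterGen₂ Λ k = (Complex.I / 2) •
      (powerGen Λ k - phaseFlip Λ * powerGen Λ k * phaseFlip Λ) := by
    rw [trotterGen₁, trotterGen₂, mul_smul_comm, smul_mul_assoc]
    module
  rw [h, powerGen_sub_phaseFlip_conj Λ hk, real_smul_op, smul_smul, smul_smul, prepUnitary]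
  congr 2
  ring

theorem eval_trotter_step₁ (Λ k : ℕ) (s : ℝ) :
    Circuit.eval (powerUnitary Λ k) [Gate.call (s / 2)]
      = NormedSpace.exp (s • trotterGen₁ Λ k) := by
  simp only [Circuit.eval, Gate.eval, List.map_cons, List.map_nil, List.prod_singleton]
  rw [powerUnitary, trotterGen₁, real_smul_op, smul_smul, powerGen]
  congr 2
  push_cast
  ring

theorem eval_trotter_step₂ (Λ k : ℕ) (s : ℝ) :
    Circuit.eval (powerUnitary Λ k) [Gate.flip, Gate.call (-(s / 2)), Gate.flip]
      = NormedSpace.exp (s • trotterGen₂ Λ k) := by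
  let R : (Op Λ)ˣ := ⟨phaseFlip Λ, phaseFlip Λ, phaseFlip_mul_self Λ, phaseFlip_mul_self Λ⟩
  have h := Matrix.exp_units_conj R ((s : ℂ) • ((-(Complex.I / 2)) • powerGen Λ k))
  have h' : s • trotterGen₂ Λ k
      = (R : Op Λ) * ((s : ℂ) • ((-(Complex.I / 2)) • powerGen Λ k)) * (↑R⁻¹ : Op Λ) := by
    rw [real_smul_op, trotterGen₂, mul_smul_comm (s : ℂ), smul_mul_assoc (s : ℂ)]
    rfl
  rw [h', h]
  simp only [Circuit.eval, Gate.eval, List.map_cons, List.map_nil, List.prod_cons, List.prod_nil,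
    mul_one]
  rw [← mul_assoc, powerUnitary, smul_smul, powerGen]
  have e : Complex.I * ((-(s / 2) : ℝ) : ℂ) = (s : ℂ) * -(Complex.I / 2) := by
    push_cast
    ring
  rw [e]
  rfl

theorem eval_prepCircuit_powerUnitary (Λ k q : ℕ) (t : ℝ) :
    (prepCircuit q t).eval (powerUnitary Λ k)
      = trotterOp (fun s => NormedSpace.exp (s • trotterGen₁ Λ k))
          (fun s => NormedSpace.exp (s • trotterGen₂ Λ k)) q t := by
  simp only [prepCircuit, eval_trotter, eval_trotter_step₁, eval_trotter_step₂]

theorem norm_eval_prepCircuit_sub_prepUnitary_le (q : ℕ) :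
    ∃ C δ : ℝ, 0 < C ∧ 0 < δ ∧ ∀ (Λ k : ℕ), 1 ≤ k → k ≤ Λ → ∀ t : ℝ, errScale Λ k t ≤ δ →
      ‖(prepCircuit (q + 1) t).eval (powerUnitary Λ k) - prepUnitary Λ k t‖
        ≤ C * errScale Λ k t ^ (2 * q + 3) := by
  let M : ℕ × ℕ → ℝ := fun i => qubitBound * (i.1 : ℝ) ^ ((i.2 : ℝ) / 2)
  have hM : ∀ i, 0 ≤ M i := fun i => mul_nonneg qubitBound_pos.le (by positivity)
  have hle : ∀ (i : ℕ × ℕ) (A : Op i.1), ‖A‖ ≤ M i → ‖(M i)⁻¹ • A‖ ≤ 1 := by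
    intro i A hA
    rw [norm_smul, norm_inv, Real.norm_of_nonneg (hM i)]
    -- The index set contains pairs with `M i = 0` (Λ = 0, k ≥ 1); there the inverse is 0 and the
    -- bound still holds.
    exact inv_mul_le_one_of_le₀ hA (hM i)
  obtain ⟨C, δ, hC, hδ, h⟩ := norm_trotterOp_sub_exp_le_uniform (ι := ℕ × ℕ) (B := fun i => Op i.1) q
    (fun i => (M i)⁻¹ • trotterGen₁ i.1 i.2) (fun i => (M i)⁻¹ • trotterGen₂ i.1 i.2)
    (fun i => hle i _ (norm_trotterGen₁_le i.1 i.2)) (fun i => hle i _ (norm_trotterGen₂_le i.1 i.2))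
  have hK := qubitBound_pos
  refine ⟨C * qubitBound ^ (2 * q + 3), δ / qubitBound, by positivity, by positivity,
    fun Λ k hk hkΛ t ht => ?_⟩
  have hMpos : 0 < M (Λ, k) := by
    have : (0 : ℝ) < Λ := by exact_mod_cast hk.trans hkΛ
    positivity
  have habs : |M (Λ, k) * t| = qubitBound * errScale Λ k t := by
    rw [abs_mul, abs_of_pos hMpos, errScale, mul_assoc]
  have key := h (Λ, k) (M (Λ, k) * t) (by
    rw [habs, mul_comm]
    exact (le_div_iff₀ hK).1 ht)
  -- Dividing the generators by `M` while multiplying time by `M` changes nothing, but turns the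
  -- small parameter into a multiple of `errScale`.
  rw [← trotterOp_comp_mul, habs, ← smul_add, smul_smul] at key
  have hcancel : ∀ s : ℝ, M (Λ, k) * s * (M (Λ, k))⁻¹ = s := by
    intro s
    field_simp
  simp only [smul_smul, hcancel] at key
  rw [eval_prepCircuit_powerUnitary, prepUnitary_eq_exp Λ hk, mul_assoc, ← mul_pow]
  exact key

/-! ### Choice of the order and assembly -/

theorem one_le_trotterIndex (p : ℝ) : 1 ≤ trotterIndex p := le_max_right _ _

theorem le_two_mul_trotterIndex_add_one (p : ℝ) : p ≤ 2 * (trotterIndex p : ℝ) + 1 := by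
  have h1 : (p - 1) / 2 ≤ (⌈(p - 1) / 2⌉₊ : ℝ) := Nat.le_ceil _
  have h2 : (⌈(p - 1) / 2⌉₊ : ℝ) ≤ (trotterIndex p : ℝ) := by
    exact_mod_cast le_max_left _ _
  linarith

theorem cost_prepCircuit_le (q : ℕ) (t : ℝ) : (prepCircuit (q + 1) t).cost ≤ 4 * 5 ^ q :=
  cost_trotter_le (fun _ => by simp [Circuit.cost, Gate.cost])
    (fun _ => by simp [Circuit.cost, Gate.cost]) q t

theorem norm_sub_le_two_of_mem_unitaryGroup {Λ : ℕ} {U V : Op Λ}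
    (hU : U ∈ unitaryGroup (Fin 2 × Fin (Λ + 1)) ℂ)
    (hV : V ∈ unitaryGroup (Fin 2 × Fin (Λ + 1)) ℂ) : ‖U - V‖ ≤ 2 := by
  refine (norm_sub_le U V).trans ?_
  rw [norm_of_mem_unitaryGroup hU, norm_of_mem_unitaryGroup hV]
  norm_num

theorem norm_eval_prepCircuit_sub_prepUnitary_le_rpow {p : ℝ} (hp : 0 ≤ p) {q : ℕ}
    (hq : p ≤ 2 * (q : ℝ) + 3) {C₀ δ₀ : ℝ} (hC₀ : 0 < C₀) (hδ₀ : 0 < δ₀) :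
    ∃ C δ : ℝ, 0 < C ∧ 0 < δ ∧ ∀ (Λ k : ℕ), 1 ≤ k → k ≤ Λ → ∀ T : ℝ → Op Λ,
      (∀ s : ℝ, errScale Λ k s ≤ δ₀ → ‖T s - powerUnitary Λ k s‖ ≤ C₀ * errScale Λ k s ^ p) →
      ∀ t : ℝ, errScale Λ k t ≤ δ →
        ‖(prepCircuit (q + 1) t).eval T - prepUnitary Λ k t‖ ≤ C * errScale Λ k t ^ p := by
  obtain ⟨C, δ, hC, hδ, h⟩ := errorStable_prepCircuit hp q C₀ δ₀ hC₀ hδ₀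
  obtain ⟨D, ε, hD, hε, h'⟩ := norm_eval_prepCircuit_sub_prepUnitary_le q
  -- The radius is at most 1 so that x^(2q+3) ≤ x^p.
  refine ⟨C + D, min δ (min ε 1), by positivity, by positivity, fun Λ k hk hkΛ T hT t ht => ?_⟩
  have h1 := h Λ k T hT t (ht.trans (min_le_left _ _))
  have h2 := h' Λ k hk hkΛ t (ht.trans ((min_le_right _ _).trans (min_le_left _ _)))
  have hx1 : errScale Λ k t ≤ 1 := ht.trans ((min_le_right _ _).trans (min_le_right _ _))
  have h3 : errScale Λ k t ^ (2 * q + 3) ≤ errScale Λ k t ^ p := by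
    rw [← Real.rpow_natCast]
    refine Real.rpow_le_rpow_of_exponent_ge' (errScale_nonneg Λ k t) hx1 hp ?_
    push_cast
    exact hq
  refine (norm_sub_le_norm_sub_add_norm_sub _ ((prepCircuit (q + 1) t).eval (powerUnitary Λ k))
    _).trans ?_
  rw [add_mul]
  exact add_le_add h1 (h2.trans (by gcongr))

end FockPrep

theorem mainTheorem7 :
    (∀ (Λ k : ℕ) (_ : 1 ≤ k) (hk : k ≤ Λ),
      (∀ t : ℝ, FockPrep.prepUnitary Λ k t ∈ Matrix.unitaryGroup (Fin 2 × Fin (Λ + 1)) ℂ) ∧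
      (∀ (n : ℕ) (t : ℝ), t = (2 * (n : ℝ) + 1) * (Real.pi / (2 * Real.sqrt (Nat.factorial k))) →
        FockPrep.prepUnitary Λ k t *ᵥ FockPrep.ket 1 0
            = (Complex.I * (-1) ^ n) • FockPrep.ket 0 ⟨k, Nat.lt_succ_of_le hk⟩ ∧
        ∀ b : Fin (Λ + 1), b ≠ 0 →
          FockPrep.prepUnitary Λ k t *ᵥ FockPrep.ket 1 b = FockPrep.ket 1 b)) ∧
    (∀ p : ℝ, 1 ≤ p →
      (∀ t : ℝ, (FockPrep.prepCircuit (FockPrep.trotterIndex p) t).cost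
          ≤ 4 * 5 ^ (FockPrep.trotterIndex p - 1)) ∧
      ∀ C₀ δ₀ : ℝ, 0 < C₀ → 0 < δ₀ → ∃ C δ : ℝ, 0 < C ∧ 0 < δ ∧
        ∀ (Λ k : ℕ), 1 ≤ k → k ≤ Λ → ∀ T : ℝ → FockPrep.Op Λ,
          (∀ s : ℝ, FockPrep.errScale Λ k s ≤ δ₀ →
            ‖T s - FockPrep.powerUnitary Λ k s‖ ≤ C₀ * FockPrep.errScale Λ k s ^ p) →
          (∀ t : ℝ, FockPrep.errScale Λ k t ≤ δ →
            ‖(FockPrep.prepCircuit (FockPrep.trotterIndex p) t).eval T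
                - FockPrep.prepUnitary Λ k t‖ ≤ C * FockPrep.errScale Λ k t ^ p) ∧
          ((∀ s : ℝ, T s ∈ Matrix.unitaryGroup (Fin 2 × Fin (Λ + 1)) ℂ) →
            ∀ t : ℝ,
              (FockPrep.prepCircuit (FockPrep.trotterIndex p) t).eval T
                ∈ Matrix.unitaryGroup (Fin 2 × Fin (Λ + 1)) ℂ ∧
              ‖(FockPrep.prepCircuit (FockPrep.trotterIndex p) t).eval T
                - FockPrep.prepUnitary Λ k t‖ ≤ C * FockPrep.errScale Λ k t ^ p)) := by
  refine ⟨fun Λ k _ hk => ⟨FockPrep.prepUnitary_mem_unitaryGroup Λ k, fun n t ht =>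
    ⟨FockPrep.prepUnitary_mulVec_ket_one_zero_of_odd hk n ht, fun b hb =>
      FockPrep.prepUnitary_mulVec_ket_one_of_ne_zero k t hb⟩⟩, fun p hp => ?_⟩
  have hq := FockPrep.le_two_mul_trotterIndex_add_one p
  obtain ⟨q, hq'⟩ := Nat.exists_eq_add_of_le' (FockPrep.one_le_trotterIndex p)
  rw [hq'] at hq ⊢
  refine ⟨FockPrep.cost_prepCircuit_le q, fun C₀ δ₀ hC₀ hδ₀ => ?_⟩
  have hp0 : 0 ≤ p := zero_le_one.trans hp
  obtain ⟨C, δ, hC, hδ, h⟩ := FockPrep.norm_eval_prepCircuit_sub_prepUnitary_le_rpow hp0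
    (q := q) (by push_cast at hq; linarith) hC₀ hδ₀
  have hδp : 0 < δ ^ p := Real.rpow_pos_of_pos hδ p
  -- The term 2/δ^p covers large times in the unitary case: two unitaries differ by at most 2, and 2
  -- ≤ (2/δ^p) x^p once x ≥ δ.
  refine ⟨C + 2 / δ ^ p, δ, by positivity, hδ, fun Λ k hk hkΛ T hT => ?_⟩
  have hx : ∀ t, 0 ≤ FockPrep.errScale Λ k t ^ p := fun t =>
    Real.rpow_nonneg (FockPrep.errScale_nonneg Λ k t) p
  have hsmall : ∀ t : ℝ, FockPrep.errScale Λ k t ≤ δ →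
      ‖(FockPrep.prepCircuit (q + 1) t).eval T - FockPrep.prepUnitary Λ k t‖
        ≤ (C + 2 / δ ^ p) * FockPrep.errScale Λ k t ^ p := fun t ht =>
    (h Λ k hk hkΛ T hT t ht).trans
      (mul_le_mul_of_nonneg_right (le_add_of_nonneg_right (by positivity)) (hx t))
  refine ⟨hsmall, fun hU t => ?_⟩
  have hmem := FockPrep.eval_mem_unitaryGroup hU (FockPrep.prepCircuit (q + 1) t)
  refine ⟨hmem, ?_⟩
  rcases le_total (FockPrep.errScale Λ k t) δ with ht | ht
  · exact hsmall t ht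
  · calc _ ≤ (2 : ℝ) := FockPrep.norm_sub_le_two_of_mem_unitaryGroup hmem
          (FockPrep.prepUnitary_mem_unitaryGroup Λ k t)
      _ = 2 / δ ^ p * δ ^ p := (div_mul_cancel₀ _ hδp.ne').symm
      _ ≤ (C + 2 / δ ^ p) * FockPrep.errScale Λ k t ^ p :=
        mul_le_mul (le_add_of_nonneg_left hC.le) (Real.rpow_le_rpow hδ.le ht hp0) hδp.le
          (by positivity)
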